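/- Theorem (Global convergence). Let $f:\mathbb R^n\to\mathbb R$ be twice continuously differentiable with locally Lipschitz second derivative and with $L_f$-Lipschitz gradient ($L_f\ge 0$), and let $g:\mathbb R^n\to\mathbb R\cup\{+\infty\}$ be proper, lower semicontinuous and $\rho$-weakly convex ($\rho\ge 0$), i.e. $g+\frac{\rho}{2}\|\cdot\|^2$ is convex. Put $\varphi=f+g$ and assume $\operatorname{argmin}\varphi\neq\emptyset$. Let $0<\gamma<\min\{1/L_f,1/\rho\}$ (with $1/0=+\infty$), and define $$\operatorname{prox}_{\gamma g}(y)=\operatorname*{argmin}_{z}\Big\{g(z)+\tfrac1{2\gamma}\|z-y\|^2\Big\},\qquad R_\gamma(x)=\gamma^{-1}\big(x-\operatorname{prox}_{\gamma g}(x-\gamma\nabla f(x))\big),$$ $$\varphi_\gamma(x)=\inf_{u}\Big\{f(x)+\langle\nabla f(x),u-x\rangle+g(u)+\tfrac1{2\gamma}\|u-x\|^2\Big\}.$$ Let $0<\mu_1<\mu_2<1$, $0<c_1<c_2<1<c_3$, $x^0\in\mathbb R^n$, $\delta_0>0$. The algorithm NTRA performs, for $k=0,1,\dots$: 1. Select $P_k\in\partial_C(\operatorname{prox}_{\gamma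 g})(x^k-\gamma\nabla f(x^k))$, where the Clarke generalized Jacobian $\partial_C F(y)$ is the convex hull of all limits of Jacobians $JF(y_i)$ along sequences $y_i\to y$ of differentiability points of $F$. Let $Q_k=I-\gamma\nabla^2 f(x^k)$ and $B_k=\gamma^{-1}Q_k(I-P_kQ_k)$. 2. If $\|R_\gamma(x^k)\|=0$ and $\lambda_{\min}(B_k)\ge 0$, stop. 3. Choose a step $d^k$ with $\|d^k\|\le\delta_k$. With $m_k(d)=\varphi_\gamma(x^k)+\langle\nabla\varphi_\gamma(x^k),d\rangle+\frac12\langle B_kd,d\rangle$, let $$r_k=\frac{\varphi_\gamma(x^k)-\varphi_\gamma(x^k+d^k)}{m_k(0)-m_k(d^k)},$$ where $r_k:=0$ if the denominator is $0$. 4. Set $x^{k+1}=x^k$ if $r_k<\mu_1$ and $x^{k+1}=x^k+d^k$ otherwise. Set $\delta_{k+1}=c_1\delta_k$ if $r_k<\mu_1$, $\delta_{k+1}=c_2\delta_k$ if $\mu_1\le r_k<\mu_2$, and $\delta_{k+1}=c_3\delta_k$ if $r_k\ge\mu_2$. If the algorithm stops at iteration $k$, put $x^j=x^k$ for all $j>k$.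 Assume that the sublevel sets $\{x:\varphi(x)\le\alpha\}$ are bounded for all real $\alpha\le\varphi(x^0)$, and that for some constant $\beta\in(0,1)$ every iteration $k$ at which the algorithm does not stop satisfies $$m_k(0)-m_k(d^k)\ \ge\ \beta\,\|\nabla\varphi_\gamma(x^k)\|\,\min\Big\{\delta_k,\frac{\|\nabla\varphi_\gamma(x^k)\|}{\|B_k\|}\Big\},$$ where the minimum is $\delta_k$ if $B_k=0$. Then $\operatorname{prox}_{\gamma g}$ is single-valued on $\mathbb R^n$, $\varphi_\gamma$ is finite and differentiable on $\mathbb R^n$, and $$\lim_{k\to\infty}\|\nabla\varphi_\gamma(x^k)\|=0.$$ -/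

import Mathlib

open Filter Topology

namespace NTRA

/-- The Euclidean space `ℝⁿ`. -/
abbrev Rn (n : ℕ) : Type := EuclideanSpace ℝ (Fin n)

variable {n : ℕ}

/-- A function with values in `ℝ ∪ {+∞}` (never `-∞`) that is not identically `+∞`. -/
def IsProper (g : Rn n → EReal) : Prop :=
  (∀ x, g x ≠ ⊥) ∧ ∃ x, g x ≠ ⊤

/-- `ρ`-weak convexity of a proper `g`: the function `g + (ρ/2)‖·‖²` is convex, that is, its
effective domain is convex and it is a real-valued convex function there. -/
def IsWeaklyConvex (ρ : ℝ) (g : Rn n → EReal) : Prop :=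
  ConvexOn ℝ {x | g x < ⊤} (fun x => (g x).toReal + ρ / 2 * ‖x‖ ^ 2)

/-- The Hessian, as the derivative of the gradient. -/
noncomputable def hess (f : Rn n → ℝ) (x : Rn n) : Rn n →L[ℝ] Rn n :=
  fderiv ℝ (gradient f) x

/-- Class `C^{2+}`: twice continuously differentiable with locally Lipschitz second derivative. -/
def IsC2Plus (f : Rn n → ℝ) : Prop :=
  ContDiff ℝ 2 f ∧ LocallyLipschitz (hess f)

/-- The objective `φ = f + g`. -/
noncomputable def objective (f : Rn n → ℝ) (g : Rn n → EReal) (x : Rn n) : EReal :=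
  (f x : EReal) + g x

/-- The proximal mapping as the set `argmin_z { g z + ‖z - y‖² / (2γ) }`. -/
def proxSet (g : Rn n → EReal) (γ : ℝ) (y : Rn n) : Set (Rn n) :=
  {z | ∀ u, g z + ((1 / (2 * γ) * ‖z - y‖ ^ 2 : ℝ) : EReal)
        ≤ g u + ((1 / (2 * γ) * ‖u - y‖ ^ 2 : ℝ) : EReal)}

open Classical in
/-- The proximal operator as a single-valued map: the element of `proxSet g γ y`
(with value `0` should that set be empty). -/
noncomputable def prox (g : Rn n → EReal) (γ : ℝ) (y : Rn n) : Rn n :=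
  if h : (proxSet g γ y).Nonempty then h.some else 0

/-- The fixed-point residual `R_γ(x) = γ⁻¹ (x - prox_{γ g}(x - γ ∇f(x)))`. -/
noncomputable def residual (f : Rn n → ℝ) (g : Rn n → EReal) (γ : ℝ) (x : Rn n) : Rn n :=
  γ⁻¹ • (x - prox g γ (x - γ • gradient f x))

/-- The forward-backward envelope with values in the extended reals. -/
noncomputable def fbeExt (f : Rn n → ℝ) (g : Rn n → EReal) (γ : ℝ) (x : Rn n) : EReal :=
  ⨅ u : Rn n,
    ((f x + inner ℝ (gradient f x) (u - x) + 1 / (2 * γ) * ‖u - x‖ ^ 2 : ℝ) : EReal) + g u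

/-- The forward-backward envelope `φ_γ` as a real-valued function. -/
noncomputable def fbe (f : Rn n → ℝ) (g : Rn n → EReal) (γ : ℝ) (x : Rn n) : ℝ :=
  (fbeExt f g γ x).toReal

/-- The Clarke generalized Jacobian `∂_C F (y)`: the convex hull of all limits of Jacobians of `F`
along sequences of differentiability points that converge to `y`. -/
def clarkeJacobian (F : Rn n → Rn n) (y : Rn n) : Set (Rn n →L[ℝ] Rn n) :=
  convexHull ℝ {A | ∃ u : ℕ → Rn n, Tendsto u atTop (𝓝 y) ∧
    (∀ i, DifferentiableAt ℝ F (u i)) ∧ Tendsto (fun i => fderiv ℝ F (u i)) atTop (𝓝 A)}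

/-- `Q(x) = I - γ ∇²f(x)`. -/
noncomputable def Qop (f : Rn n → ℝ) (γ : ℝ) (x : Rn n) : Rn n →L[ℝ] Rn n :=
  ContinuousLinearMap.id ℝ (Rn n) - γ • hess f x

/-- The Hessian approximant `B = γ⁻¹ Q (I - P Q)` at `x`. -/
noncomputable def Bop (f : Rn n → ℝ) (γ : ℝ) (x : Rn n) (P : Rn n →L[ℝ] Rn n) :
    Rn n →L[ℝ] Rn n :=
  γ⁻¹ • (Qop f γ x).comp (ContinuousLinearMap.id ℝ (Rn n) - P.comp (Qop f γ x))

/-- The quadratic model `m(d) = φ_γ(x) + ⟨∇φ_γ(x), d⟩ + ⟨B d, d⟩ / 2`. -/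
noncomputable def model (f : Rn n → ℝ) (g : Rn n → EReal) (γ : ℝ) (x : Rn n)
    (B : Rn n →L[ℝ] Rn n) (d : Rn n) : ℝ :=
  fbe f g γ x + inner ℝ (gradient (fbe f g γ) x) d + 1 / 2 * inner ℝ (B d) d

/-- Actual reduction divided by predicted reduction. A step with predicted reduction `0` has
ratio `0`, so it is rejected. -/
noncomputable def ratio (f : Rn n → ℝ) (g : Rn n → EReal) (γ : ℝ) (x : Rn n)
    (B : Rn n →L[ℝ] Rn n) (d : Rn n) : ℝ :=
  (fbe f g γ x - fbe f g γ (x + d)) / (model f g γ x B 0 - model f g γ x B d)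

/-- The stopping test: `‖R_γ(x)‖ = 0` and the smallest eigenvalue of `B` is nonnegative. -/
def Stops (f : Rn n → ℝ) (g : Rn n → EReal) (γ : ℝ) (x : Rn n) (B : Rn n →L[ℝ] Rn n) : Prop :=
  ‖residual f g γ x‖ = 0 ∧
    ∀ l : ℝ, Module.End.HasEigenvalue (B : Rn n →ₗ[ℝ] Rn n) l → 0 ≤ l

/-- The sequences of iterates `x k`, radii `δ k`, selected generalized Jacobians `P k` and candidate
steps `d k` form a run of the nonsmooth trust-region algorithm. Once the stopping test succeeds,
the run is continued by constant repetition, so finite and infinite runs are both covered. -/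
structure IsRun (f : Rn n → ℝ) (g : Rn n → EReal) (γ μ₁ μ₂ c₁ c₂ c₃ : ℝ)
    (x : ℕ → Rn n) (δ : ℕ → ℝ) (P : ℕ → Rn n →L[ℝ] Rn n) (d : ℕ → Rn n) : Prop where
  radius_pos : 0 < δ 0
  select : ∀ k, P k ∈ clarkeJacobian (prox g γ) (x k - γ • gradient f (x k))
  feasible : ∀ k, ¬ Stops f g γ (x k) (Bop f γ (x k) (P k)) → ‖d k‖ ≤ δ k
  iterate : ∀ k, ¬ Stops f g γ (x k) (Bop f γ (x k) (P k)) →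
    x (k + 1) = if ratio f g γ (x k) (Bop f γ (x k) (P k)) (d k) < μ₁ then x k else x k + d k
  radius : ∀ k, ¬ Stops f g γ (x k) (Bop f γ (x k) (P k)) →
    δ (k + 1) =
      if ratio f g γ (x k) (Bop f γ (x k) (P k)) (d k) < μ₁ then c₁ * δ k
      else if ratio f g γ (x k) (Bop f γ (x k) (P k)) (d k) < μ₂ then c₂ * δ k
      else c₃ * δ k
  stopped : ∀ k, Stops f g γ (x k) (Bop f γ (x k) (P k)) →
    x (k + 1) = x k ∧ δ (k + 1) = δ k ∧ P (k + 1) = P k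

/-- The step `d` decreases the model by at least the fraction `β` of
`‖∇φ_γ(x)‖ min {δ, ‖∇φ_γ(x)‖ / ‖B‖}`, where the quotient is `+∞` if `B = 0`. -/
def SufficientDecrease (f : Rn n → ℝ) (g : Rn n → EReal) (γ β : ℝ) (x : Rn n) (δ : ℝ)
    (B : Rn n →L[ℝ] Rn n) (d : Rn n) : Prop :=
  β * ‖gradient (fbe f g γ) x‖ *
      (if ‖B‖ = 0 then δ else min δ (‖gradient (fbe f g γ) x‖ / ‖B‖))
    ≤ model f g γ x B 0 - model f g γ x B d

end NTRA

/-! Completing the square turns the forward-backward envelope into `f - γ/2 ‖∇f‖²` plus the Moreau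
envelope of `g` at the forward point `x - γ∇f(x)`. Since `γρ < 1`, the proximal objective is
strongly convex, so the prox is single-valued and Lipschitz, which makes the Moreau envelope
differentiable. Hence `φ_γ` has gradient `Q(x)* R_γ(x)`, continuous because `∇²f` and the prox are
(`hasGradientAt_fbe`).

All nonsmoothness is thus confined to `B_k`, and the Clarke elements enter only through the bound
`‖P_k‖ ≤ K`, with `K` a Lipschitz constant of the prox. So `‖B_k‖` is uniformly bounded, and the run
is a trust-region method for a `C¹` function with bounded model Hessians, which
`tendsto_norm_gradient_of_trustRegion` treats in general. That lemma also needs a lower bound and a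
bounded initial sublevel set. Both follow from `γL < 1`: a forward-backward step from `x` reaches an
objective value below `φ_γ(x)` by a multiple of the squared step length
(`objective_prox_add_le_fbe`).

If the algorithm stops, the residual is zero from then on, and so is the gradient. -/

namespace NTRA

/-! ### Trust-region convergence for `C¹` functions with bounded model Hessians. -/

section TrustRegion

variable {E : Type*} [NormedAddCommGroup E] [InnerProductSpace ℝ E] [CompleteSpace E]
  [ProperSpace E]

/-- A continuous gradient makes the first order Taylor expansion uniform on bounded sets. -/
theorem exists_uniform_taylor {φ : E → ℝ} {G : E → E} (hG : Continuous G)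
    (hφ : ∀ u, HasGradientAt φ (G u) u) {S : Set E} (hS : Bornology.IsBounded S)
    {η : ℝ} (hη : 0 < η) :
    ∃ s > 0, ∀ u ∈ S, ∀ v, ‖v‖ ≤ s → |φ (u + v) - φ u - inner ℝ (G u) v| ≤ η * ‖v‖ := by
  obtain ⟨R, hR⟩ := hS.subset_closedBall 0
  have hK : IsCompact (Metric.closedBall (0 : E) (R + 1)) := isCompact_closedBall _ _
  have huc := hK.uniformContinuousOn_of_continuous hG.continuousOn
  rw [Metric.uniformContinuousOn_iff_le] at huc
  obtain ⟨s, hs, hsu⟩ := huc η hη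
  -- The cap `1` keeps the ball around `u` inside radius `R + 1`, where `G` is uniformly continuous.
  refine ⟨min s 1, lt_min hs one_pos, fun u hu v hv => ?_⟩
  have huR : ‖u‖ ≤ R := by simpa using hR hu
  have hs1 : min s 1 ≤ 1 := min_le_right _ _
  have key := (convex_closedBall u (min s 1)).norm_image_sub_le_of_norm_hasFDerivWithin_le'
    (f := φ) (f' := fun w => InnerProductSpace.toDual ℝ E (G w))
    (φ := InnerProductSpace.toDual ℝ E (G u)) (C := η) (x := u) (y := u + v)
    (fun w _ => (hφ w).hasFDerivAt.hasFDerivWithinAt) (fun w hw => ?_)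
    (Metric.mem_closedBall_self (by positivity)) (by simpa using hv)
  · simpa [Real.norm_eq_abs] using key
  · rw [← map_sub, LinearIsometryEquiv.norm_map, ← dist_eq_norm]
    have hwu : dist w u ≤ min s 1 := hw
    have hwn : ‖w‖ ≤ R + 1 := by
      have := norm_le_norm_add_norm_sub' w u
      rw [← dist_eq_norm] at this
      linarith
    exact hsu w (by simpa using hwn) u (by simp; linarith) (hwu.trans (min_le_left _ _))

/-- Global convergence of the trust-region method for a continuously differentiable function with a
bounded initial sublevel set and uniformly bounded model Hessians. -/
theorem tendsto_norm_gradient_of_trustRegion {φ : E → ℝ} {G : E → E} (hG : Continuous G)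
    (hφ : ∀ u, HasGradientAt φ (G u) u) {x d : ℕ → E} {δ : ℕ → ℝ} {B : ℕ → E →L[ℝ] E}
    {m M β μ₁ μ₂ c₁ c₂ c₃ : ℝ} (hm : ∀ u, m ≤ φ u)
    (hlevel : Bornology.IsBounded {u | φ u ≤ φ (x 0)})
    (hM : 0 < M) (hB : ∀ k, ‖B k‖ ≤ M) (hβ : 0 < β)
    (hμ₁ : 0 < μ₁) (hμ : μ₁ < μ₂) (hμ₂ : μ₂ < 1)
    (hc₁ : 0 < c₁) (hc : c₁ < c₂) (hc₂ : c₂ < 1) (hc₃ : 1 < c₃)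
    {pred r : ℕ → ℝ}
    (hpred : ∀ k, pred k = -(inner ℝ (G (x k)) (d k) + 1 / 2 * inner ℝ (B k (d k)) (d k)))
    (hr : ∀ k, r k = (φ (x k) - φ (x k + d k)) / pred k)
    (hδ0 : 0 < δ 0) (hd : ∀ k, ‖d k‖ ≤ δ k)
    (hx : ∀ k, x (k + 1) = if r k < μ₁ then x k else x k + d k)
    (hδ : ∀ k, δ (k + 1) = if r k < μ₁ then c₁ * δ k else if r k < μ₂ then c₂ * δ k else c₃ * δ k)
    (hdec : ∀ k, β * ‖G (x k)‖ * min (δ k) (‖G (x k)‖ / M) ≤ pred k) :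
    Tendsto (fun k => ‖G (x k)‖) atTop (𝓝 0) := by
  have hδpos : ∀ k, 0 < δ k := by
    intro k
    induction k with
    | zero => exact hδ0
    | succ k ih =>
      rw [hδ]
      split_ifs
      · exact mul_pos hc₁ ih
      · exact mul_pos (hc₁.trans hc) ih
      · exact mul_pos (one_pos.trans hc₃) ih
  have hpred0 : ∀ k, 0 ≤ pred k := fun k => le_trans (by have := hδpos k; positivity) (hdec k)
  -- decrease at accepted steps
  have hacc : ∀ k, μ₁ ≤ r k → μ₁ * pred k ≤ φ (x k) - φ (x (k + 1)) := by
    intro k hk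
    rw [hx, if_neg (not_lt.2 hk)]
    rcases (hpred0 k).eq_or_lt with h0 | h0
    -- A zero prediction gives ratio `0 < μ₁`, so such a step is never accepted.
    · rw [hr, ← h0, div_zero] at hk
      linarith
    · rwa [hr, le_div_iff₀ h0] at hk
  have hanti : Antitone fun k => φ (x k) := by
    refine antitone_nat_of_succ_le fun k => ?_
    by_cases hk : r k < μ₁
    · rw [hx, if_pos hk]
    · have := hacc k (not_lt.1 hk)
      have := mul_nonneg hμ₁.le (hpred0 k)
      linarith
  have hlev : ∀ k, x k ∈ {u | φ u ≤ φ (x 0)} := fun k => hanti (Nat.zero_le k)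
  have hconv : ∃ l, Tendsto (fun k => φ (x k)) atTop (𝓝 l) :=
    ⟨_, tendsto_atTop_ciInf hanti ⟨m, by rintro _ ⟨k, rfl⟩; exact hm _⟩⟩
  obtain ⟨l, hl⟩ := hconv
  have hll : ∀ k, l ≤ φ (x k) := fun k => hanti.le_of_tendsto hl k
  have hpredge : ∀ ε > 0, ∀ k, ε ≤ ‖G (x k)‖ → β * ε * min (δ k) (ε / M) ≤ pred k := by
    intro ε hε k hk
    refine le_trans ?_ (hdec k)
    have := hδpos k
    gcongr
  -- small radii give very successful steps
  have hvery : ∀ ε > 0, ∃ δ' > 0, ∀ k, ε ≤ ‖G (x k)‖ → δ k ≤ δ' → μ₂ ≤ r k := by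
    intro ε hε
    have hμ₂' : 0 < 1 - μ₂ := by linarith
    obtain ⟨s, hs, hsu⟩ := exists_uniform_taylor hG hφ hlevel
      (η := (1 - μ₂) * (β * ε) / 2) (by positivity)
    -- The bound `s` controls the Taylor error, `ε / M` makes the radius the active term in the
    -- predicted decrease, and the last term controls the curvature. The Taylor and curvature errors
    -- each cost at most half of `(1 - μ₂) β ε δ k ≤ (1 - μ₂) pred k`.
    refine ⟨min s (min (ε / M) ((1 - μ₂) * (β * ε) / M)), by positivity, fun k hk hδk => ?_⟩
    have h1 := hδk.trans (min_le_left _ _)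
    have h2 := (hδk.trans (min_le_right _ _)).trans (min_le_left _ _)
    have h3 := (hδk.trans (min_le_right _ _)).trans (min_le_right _ _)
    rw [le_div_iff₀ hM] at h3
    have hp := hpredge ε hε k hk
    rw [min_eq_left h2] at hp
    have hδk0 := hδpos k
    have hp0 : 0 < pred k := lt_of_lt_of_le (by positivity) hp
    have ht := hsu (x k) (hlev k) (d k) ((hd k).trans h1)
    have ht' := (abs_le.1 ht).2
    have hBd : -(M * δ k * δ k) ≤ inner ℝ (B k (d k)) (d k) := by
      have := abs_real_inner_le_norm (B k (d k)) (d k)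
      have h4 : ‖B k (d k)‖ ≤ M * δ k :=
        ((B k).le_opNorm _).trans (by gcongr; exacts [hB k, hd k])
      have h5 : ‖B k (d k)‖ * ‖d k‖ ≤ M * δ k * δ k := by gcongr; exact hd k
      linarith [(abs_le.1 this).1]
    rw [hr, le_div_iff₀ hp0]
    have h6 : (1 - μ₂) * (β * ε) / 2 * ‖d k‖ ≤ (1 - μ₂) * (β * ε) / 2 * δ k := by
      gcongr; exact hd k
    have h7 : δ k * M * δ k ≤ (1 - μ₂) * (β * ε) * δ k := by gcongr
    have h8 : (1 - μ₂) * (β * ε * δ k) ≤ (1 - μ₂) * pred k := by gcongr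
    have := hpred k
    linarith
  -- the gradients are not bounded away from zero
  have hliminf : ∀ ε > 0, ∀ K, ∃ k ≥ K, ‖G (x k)‖ < ε := by
    intro ε hε K
    by_contra! hcon
    obtain ⟨δ', hδ', hδr⟩ := hvery ε hε
    -- Radii at most `δ'` expand, and a larger radius shrinks by a factor no smaller than `c₁`; so
    -- no radius after `K` falls below `η`.
    set η := min (δ K) (c₁ * δ') with hη
    have hη0 : 0 < η := lt_min (hδpos K) (by positivity)
    have hlow : ∀ k ≥ K, η ≤ δ k := by
      intro k hk
      induction k, hk using Nat.le_induction with
      | base => exact min_le_left _ _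
      | succ k hk ih =>
        have hk0 := hδpos k
        by_cases hkδ : δ k ≤ δ'
        · have := hδr k (hcon k hk) hkδ
          rw [hδ, if_neg (by linarith), if_neg (by linarith)]
          nlinarith
        · have h1 : c₁ * δ' ≤ c₁ * δ k := by gcongr; linarith
          have h2 : η ≤ c₁ * δ k := (min_le_right _ _).trans h1
          rw [hδ]
          split_ifs
          · exact h2
          · nlinarith
          · nlinarith
    set σ := μ₁ * (β * ε * min η (ε / M)) with hσ
    have hσ0 : 0 < σ := by positivity
    have hdecσ : ∀ k ≥ K, μ₁ ≤ r k → σ ≤ φ (x k) - φ (x (k + 1)) := by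
      intro k hk hkr
      refine le_trans ?_ (hacc k hkr)
      have h1 := hpredge ε hε k (hcon k hk)
      have h2 := hlow k hk
      refine mul_le_mul_of_nonneg_left (le_trans ?_ h1) hμ₁.le
      gcongr
    -- Each accepted step after `K` would lower `φ` by at least `σ`. As the values converge,
    -- eventually every step is rejected, and the radii then decay geometrically, against the bound
    -- `η`.
    obtain ⟨N, hN⟩ := (eventually_atTop.1 (hl.eventually_lt_const (show l < l + σ by linarith)))
    have hfail : ∀ k ≥ max N K, r k < μ₁ := by
      intro k hk
      by_contra hkr
      have h1 := hdecσ k (le_of_max_le_right hk) (not_lt.1 hkr)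
      have h2 := hN k (le_of_max_le_left hk)
      have h3 := hll (k + 1)
      linarith
    have hgeo : ∀ j, δ (max N K + j) = c₁ ^ j * δ (max N K) := by
      intro j
      induction j with
      | zero => simp
      | succ j ih =>
        rw [← add_assoc, hδ, if_pos (hfail _ (by omega)), ih]
        ring
    have hlim : Tendsto (fun j => c₁ ^ j * δ (max N K)) atTop (𝓝 (0 * δ (max N K))) :=
      (tendsto_pow_atTop_nhds_zero_of_lt_one hc₁.le (by linarith)).mul_const _
    rw [zero_mul] at hlim
    have : η ≤ 0 := ge_of_tendsto' hlim fun j => by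
      rw [← hgeo]; exact hlow _ (by omega)
    linarith
  -- the whole sequence converges
  rw [Metric.tendsto_atTop]
  intro ε' hε'
  set ε := ε' / 2 with hεdef
  have hε : 0 < ε := by positivity
  obtain ⟨R, hR⟩ := hlevel.subset_closedBall 0
  have huc := (isCompact_closedBall (0 : E) R).uniformContinuousOn_of_continuous hG.continuousOn
  rw [Metric.uniformContinuousOn_iff_le] at huc
  obtain ⟨s, hs, hsu⟩ := huc (ε / 2) (by positivity)
  set κ := μ₁ * (β * ε) with hκ
  have hκ0 : 0 < κ := by positivity
  -- After `N` the total decrease still available is less than `κ * min (ε / M) s`. The first term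
  -- rules out radii above `ε / M` at accepted steps while the gradient is at least `ε`; the second
  -- bounds the distance travelled by `s`.
  obtain ⟨N, hN⟩ := eventually_atTop.1
    (hl.eventually_lt_const (show l < l + κ * min (ε / M) s by
      have : 0 < κ * min (ε / M) s := by positivity
      linarith))
  refine ⟨N, fun k hk => ?_⟩
  rw [dist_zero_right, norm_norm]
  by_contra! hcon
  have hex : ∃ j, ‖G (x (k + j))‖ < ε := by
    obtain ⟨i, hi, hi'⟩ := hliminf ε hε k
    exact ⟨i - k, by rwa [Nat.add_sub_cancel' hi]⟩
  classical
  -- Starting from gradient norm at least `2ε`, `k + J` is the first index where it is below `ε`.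
  -- Until then each unit of movement lowers `φ` by at least `κ`, so `x` moves by at most `s`, over
  -- which `G` varies by at most `ε / 2`: a contradiction.
  set J := Nat.find hex with hJ
  have hJlt : ‖G (x (k + J))‖ < ε := Nat.find_spec hex
  have hJge : ∀ j < J, ε ≤ ‖G (x (k + j))‖ := fun j hj => not_lt.1 (Nat.find_min hex hj)
  have hmove : ∀ j ≤ J, κ * ‖x (k + j) - x k‖ ≤ φ (x k) - φ (x (k + j)) := by
    intro j
    induction j with
    | zero => simp
    | succ j ih =>
      intro hj
      have ih := ih (by omega)
      rw [← add_assoc]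
      by_cases hkr : r (k + j) < μ₁
      · rwa [hx, if_pos hkr]
      · have h1 := hacc _ (not_lt.1 hkr)
        have h2 := hpredge ε hε _ (hJge j (by omega))
        have h3 : κ * min (δ (k + j)) (ε / M) ≤ φ (x (k + j)) - φ (x (k + j + 1)) := by
          refine le_trans ?_ h1
          rw [hκ, mul_assoc]
          exact mul_le_mul_of_nonneg_left h2 hμ₁.le
        have h4 : φ (x (k + j)) - φ (x (k + j + 1)) < κ * (ε / M) := by
          have e1 := hN (k + j) (by omega)
          have e2 := hll (k + j + 1)
          have e3 : κ * min (ε / M) s ≤ κ * (ε / M) := by gcongr; exact min_le_left _ _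
          linarith
        have h5 : δ (k + j) ≤ ε / M := by
          by_contra! h
          rw [min_eq_right h.le] at h3
          linarith
        rw [min_eq_left h5] at h3
        have h6 : ‖x (k + j + 1) - x k‖ ≤ ‖x (k + j) - x k‖ + δ (k + j) := by
          rw [hx, if_neg hkr, add_sub_right_comm]
          exact (norm_add_le _ _).trans (by gcongr; exact hd _)
        have := mul_le_mul_of_nonneg_left h6 hκ0.le
        linarith
  have h1 := hmove J le_rfl
  have h2 : φ (x k) - φ (x (k + J)) < κ * s := by
    have e1 := hN k hk
    have e2 := hll (k + J)
    have e3 : κ * min (ε / M) s ≤ κ * s := by gcongr; exact min_le_right _ _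
    linarith
  have h3 : ‖x (k + J) - x k‖ ≤ s := (lt_of_mul_lt_mul_left (h1.trans_lt h2) hκ0.le).le
  have h4 := hsu (x (k + J)) (hR (hlev _)) (x k) (hR (hlev _)) (by rwa [dist_eq_norm])
  rw [dist_eq_norm] at h4
  have h5 := norm_sub_norm_le (G (x k)) (G (x (k + J)))
  rw [norm_sub_rev] at h5
  linarith

end TrustRegion

end NTRA

namespace NTRA
variable {n : ℕ}

/-! ### Descent lemma and the proximal map. -/

/-- The descent lemma: a function with `L`-Lipschitz gradient differs from its first order Taylor
expansion by at most `L / 2 * ‖v‖ ^ 2`. -/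
theorem abs_sub_sub_inner_le_of_lipschitzWith_gradient {E : Type*} [NormedAddCommGroup E]
    [InnerProductSpace ℝ E] [CompleteSpace E] {f : E → ℝ} {G : E → E} {L : NNReal}
    (hf : ∀ u, HasGradientAt f (G u) u) (hG : LipschitzWith L G) (u v : E) :
    |f (u + v) - f u - inner ℝ (G u) v| ≤ L / 2 * ‖v‖ ^ 2 := by
  have hline : ∀ t : ℝ, HasDerivAt (fun t : ℝ => u + t • v) v t := fun t => by
    simpa using ((hasDerivAt_id t).smul_const v).const_add u
  have hder : ∀ t : ℝ, HasDerivAt (fun t : ℝ => f (u + t • v) - f u - t * inner ℝ (G u) v)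
      (inner ℝ (G (u + t • v)) v - inner ℝ (G u) v) t := fun t => by
    have h1 := (hf (u + t • v)).hasFDerivAt.comp_hasDerivAt t (hline t)
    have h2 := (h1.sub_const (f u)).sub ((hasDerivAt_id t).mul_const (inner ℝ (G u) v))
    exact h2.congr_deriv (by simp)
  have hB : ∀ t : ℝ, HasDerivAt (fun t : ℝ => L / 2 * ‖v‖ ^ 2 * t ^ 2) (L * ‖v‖ ^ 2 * t) t :=
    fun t => by
      have := (hasDerivAt_pow 2 t).const_mul (L / 2 * ‖v‖ ^ 2)
      refine this.congr_deriv ?_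
      push_cast
      ring
  -- The Taylor remainder along `u + t • v` is compared with `L/2 ‖v‖² t²`, whose derivative
  -- dominates its own on `[0, 1]`.
  have key := image_norm_le_of_norm_deriv_right_le_deriv_boundary (a := 0) (b := 1)
    (fun t _ => (hder t).continuousAt.continuousWithinAt)
    (fun t _ => (hder t).hasDerivWithinAt) (by simp) hB (fun t ht => ?_)
    (Set.right_mem_Icc.2 zero_le_one)
  · simpa using key
  · rw [← inner_sub_left]
    refine (norm_inner_le_norm _ _).trans ?_
    have h1 := hG.dist_le_mul (u + t • v) u
    rw [dist_eq_norm, dist_eq_norm, add_sub_cancel_left, norm_smul, Real.norm_of_nonneg ht.1] at h1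
    calc _ ≤ L * (t * ‖v‖) * ‖v‖ := by gcongr
      _ = _ := by ring

theorem IsProper.coe_toReal {g : Rn n → EReal} (hg : IsProper g) {u : Rn n} (hu : g u ≠ ⊤) :
    ((g u).toReal : EReal) = g u :=
  EReal.coe_toReal hu (hg.1 u)

theorem ne_top_of_mem_proxSet {g : Rn n → EReal} {γ : ℝ} (hg : IsProper g) {y z : Rn n}
    (hz : z ∈ proxSet g γ y) : g z ≠ ⊤ := by
  intro h
  obtain ⟨u, hu⟩ := hg.2
  have := hz u
  rw [h, EReal.top_add_coe, top_le_iff, ← hg.coe_toReal hu] at this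
  exact EReal.coe_ne_top _ (by rwa [← EReal.coe_add] at this)

theorem toReal_add_le_of_mem_proxSet {g : Rn n → EReal} {γ : ℝ} (hg : IsProper g) {y z : Rn n}
    (hz : z ∈ proxSet g γ y) {u : Rn n} (hu : g u ≠ ⊤) :
    (g z).toReal + 1 / (2 * γ) * ‖z - y‖ ^ 2 ≤ (g u).toReal + 1 / (2 * γ) * ‖u - y‖ ^ 2 := by
  have := hz u
  rw [← hg.coe_toReal hu, ← hg.coe_toReal (ne_top_of_mem_proxSet hg hz)] at this
  exact_mod_cast this

/-- A proper lower semicontinuous function minorized by a concave quadratic of curvature less than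
`1 / γ` has nonempty proximal sets. -/
theorem proxSet_nonempty {g : Rn n → EReal} {γ a b L : ℝ} (hg : IsProper g)
    (hlsc : LowerSemicontinuous g) (hγ : 0 < γ) (hγL : γ * L < 1) (hb : 0 ≤ b)
    (hlow : ∀ u, g u ≠ ⊤ → a - b * ‖u‖ - L / 2 * ‖u‖ ^ 2 ≤ (g u).toReal) (y : Rn n) :
    (proxSet g γ y).Nonempty := by
  obtain ⟨u₀, hu₀⟩ := hg.2
  set T := (g u₀).toReal + 1 / (2 * γ) * ‖u₀ - y‖ ^ 2 with hT
  set s := 1 / (2 * γ) - L / 2 with hs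
  have hs0 : 0 < s := by
    have : s = (1 - γ * L) / (2 * γ) := by rw [hs]; field_simp
    rw [this]
    have : 0 < 1 - γ * L := by linarith
    positivity
  set V := b + 1 / γ * ‖y‖ with hV
  have hV0 : 0 ≤ V := by positivity
  -- The proximal objective is at least `a + s‖u‖² - V‖u‖`. For `‖u‖ ≥ R` this is at least `T`, its
  -- value at `u₀`, so minimizing over a ball containing `u₀` suffices; the `+ 1` ensures `‖u‖ ≥ 1`.
  set R := V / s + |T - a| / s + 1 with hR
  have hlsc' : LowerSemicontinuous fun u => g u + ((1 / (2 * γ) * ‖u - y‖ ^ 2 : ℝ) : EReal) := by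
    refine hlsc.add' ?_ fun u => EReal.continuousAt_add (Or.inr (EReal.coe_ne_bot _))
      (Or.inr (EReal.coe_ne_top _))
    refine Continuous.lowerSemicontinuous ?_
    refine continuous_coe_real_ereal.comp ?_
    fun_prop
  obtain ⟨z, -, hzmin⟩ := (hlsc'.lowerSemicontinuousOn _).exists_isMinOn
    (s := Metric.closedBall (0 : Rn n) (max R ‖u₀‖))
    ⟨u₀, by simp⟩ (isCompact_closedBall _ _)
  refine ⟨z, fun u => ?_⟩
  by_cases hu : ‖u‖ ≤ max R ‖u₀‖
  · exact hzmin (by simpa using hu)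
  refine (hzmin (show u₀ ∈ _ by simp)).trans ?_
  by_cases htop : g u = ⊤
  · rw [htop, EReal.top_add_coe]
    exact le_top
  simp only
  rw [← hg.coe_toReal hu₀, ← hg.coe_toReal htop]
  norm_cast
  rw [← hT]
  have hRu : R ≤ ‖u‖ := (le_max_left _ _).trans (not_le.1 hu).le
  have h1 := hlow u htop
  have h2 : (‖u‖ - ‖y‖) ^ 2 ≤ ‖u - y‖ ^ 2 := by
    rw [sq_le_sq, abs_of_nonneg (norm_nonneg (u - y))]
    exact abs_norm_sub_norm_le u y
  have h3 : 1 / (2 * γ) * (‖u‖ - ‖y‖) ^ 2 ≤ 1 / (2 * γ) * ‖u - y‖ ^ 2 := by gcongr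
  have h4 : 1 / (2 * γ) * (‖u‖ - ‖y‖) ^ 2 =
      1 / (2 * γ) * ‖u‖ ^ 2 - 1 / γ * ‖y‖ * ‖u‖ + 1 / (2 * γ) * ‖y‖ ^ 2 := by
    field_simp
    ring
  have h5 : 0 ≤ 1 / (2 * γ) * ‖y‖ ^ 2 := by positivity
  have h6 : V + |T - a| + s ≤ s * ‖u‖ := by
    calc _ = s * R := by rw [hR]; field_simp
      _ ≤ _ := by gcongr
  have h7 : 1 ≤ ‖u‖ := by
    have e1 := div_nonneg hV0 hs0.le
    have e2 := div_nonneg (abs_nonneg (T - a)) hs0.le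
    linarith
  have h8 : |T - a| ≤ ‖u‖ * (s * ‖u‖ - V) := by
    have h9 : |T - a| ≤ s * ‖u‖ - V := by linarith
    have h10 : 0 ≤ s * ‖u‖ - V := (abs_nonneg _).trans h9
    nlinarith
  have h9 := le_abs_self (T - a)
  have h10 : ‖u‖ * (s * ‖u‖ - V) =
      1 / (2 * γ) * ‖u‖ ^ 2 - L / 2 * ‖u‖ ^ 2 - b * ‖u‖ - 1 / γ * ‖y‖ * ‖u‖ := by
    rw [hs, hV]; ring
  linarith

theorem norm_convexCombination_sq (p q : Rn n) (t : ℝ) :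
    ‖(1 - t) • p + t • q‖ ^ 2 =
      (1 - t) * ‖p‖ ^ 2 + t * ‖q‖ ^ 2 - t * (1 - t) * ‖q - p‖ ^ 2 := by
  rw [norm_add_sq_real, norm_sub_sq_real, norm_smul, norm_smul, mul_pow, mul_pow,
    inner_smul_left, inner_smul_right, real_inner_comm p q]
  simp only [Real.norm_eq_abs, sq_abs, conj_trivial]
  ring

/-- Quadratic growth of the strongly convex proximal objective at its minimizer. -/
theorem proxSet_quadratic_growth {g : Rn n → EReal} {γ ρ : ℝ} (hg : IsProper g)
    (hw : IsWeaklyConvex ρ g) {y z : Rn n} (hz : z ∈ proxSet g γ y) {u : Rn n} (hu : g u ≠ ⊤) :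
    (g z).toReal + 1 / (2 * γ) * ‖z - y‖ ^ 2 + (1 / (2 * γ) - ρ / 2) * ‖u - z‖ ^ 2 ≤
      (g u).toReal + 1 / (2 * γ) * ‖u - y‖ ^ 2 := by
  have hz' := ne_top_of_mem_proxSet hg hz
  -- Minimality of `z` is tested at `(1 - t) • z + t • u`. Weak convexity bounds `g` there, the
  -- common factor `t` is divided out, and `t → 0` recovers the full growth constant.
  have key : ∀ t ∈ Set.Ioo (0 : ℝ) 1,
      (g z).toReal + 1 / (2 * γ) * ‖z - y‖ ^ 2 + (1 / (2 * γ) - ρ / 2) * ‖u - z‖ ^ 2 * (1 - t) ≤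
        (g u).toReal + 1 / (2 * γ) * ‖u - y‖ ^ 2 := by
    rintro t ⟨ht0, ht1⟩
    have hzD : z ∈ {x | g x < ⊤} := lt_top_iff_ne_top.2 hz'
    have huD : u ∈ {x | g x < ⊤} := lt_top_iff_ne_top.2 hu
    have hwD := hw.1 hzD huD (sub_nonneg.2 ht1.le) ht0.le (sub_add_cancel 1 t)
    have h1 := hw.2 hzD huD (sub_nonneg.2 ht1.le) ht0.le (sub_add_cancel 1 t)
    have h2 := toReal_add_le_of_mem_proxSet hg hz (ne_of_lt hwD)
    have h3 := norm_convexCombination_sq z u t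
    have h4 := norm_convexCombination_sq (z - y) (u - y) t
    rw [show (1 - t) • (z - y) + t • (u - y) = (1 - t) • z + t • u - y by module,
      sub_sub_sub_cancel_right] at h4
    simp only [smul_eq_mul] at h1
    rw [h3] at h1
    rw [h4] at h2
    refine le_of_mul_le_mul_left ?_ ht0
    linarith
  have hlim : Tendsto (fun t : ℝ => (g z).toReal + 1 / (2 * γ) * ‖z - y‖ ^ 2 +
      (1 / (2 * γ) - ρ / 2) * ‖u - z‖ ^ 2 * (1 - t)) (𝓝[>] 0)
      (𝓝 ((g z).toReal + 1 / (2 * γ) * ‖z - y‖ ^ 2 +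
      (1 / (2 * γ) - ρ / 2) * ‖u - z‖ ^ 2 * (1 - 0))) :=
    (Continuous.tendsto (by fun_prop) 0).mono_left nhdsWithin_le_nhds
  rw [sub_zero, mul_one] at hlim
  refine le_of_tendsto hlim ?_
  filter_upwards [Ioo_mem_nhdsGT one_pos] with t ht using key t ht

/-- Proximal points depend Lipschitz continuously on the prox center. -/
theorem norm_sub_le_of_mem_proxSet {g : Rn n → EReal} {γ ρ : ℝ} (hg : IsProper g)
    (hw : IsWeaklyConvex ρ g) (hγ : 0 < γ) (hγρ : γ * ρ < 1) {y y' z z' : Rn n}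
    (hz : z ∈ proxSet g γ y) (hz' : z' ∈ proxSet g γ y') :
    ‖z' - z‖ ≤ (1 - γ * ρ)⁻¹ * ‖y' - y‖ := by
  have h1 := proxSet_quadratic_growth hg hw hz (ne_top_of_mem_proxSet hg hz')
  have h2 := proxSet_quadratic_growth hg hw hz' (ne_top_of_mem_proxSet hg hz)
  have hpos : 0 < 1 - γ * ρ := by linarith
  -- Adding the two growth inequalities cancels the values of `g`; the remaining squares collapse to
  -- one inner product, to which Cauchy–Schwarz applies.
  have h3 : ‖z' - y‖ ^ 2 - ‖z - y‖ ^ 2 + ‖z - y'‖ ^ 2 - ‖z' - y'‖ ^ 2 =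
      2 * inner ℝ (y' - y) (z' - z) := by
    simp only [norm_sub_sq_real, inner_sub_left, inner_sub_right,
      real_inner_comm z y, real_inner_comm z' y, real_inner_comm z y', real_inner_comm z' y']
    ring
  have h4 := real_inner_le_norm (y' - y) (z' - z)
  rw [norm_sub_rev z z'] at h2
  have h5 : (1 - γ * ρ) * ‖z' - z‖ ^ 2 ≤ ‖y' - y‖ * ‖z' - z‖ := by
    have h6 : 2 * ((1 / (2 * γ) - ρ / 2) * ‖z' - z‖ ^ 2) ≤
        1 / (2 * γ) * (2 * inner ℝ (y' - y) (z' - z)) := by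
      rw [← h3]; linarith
    have h7 := mul_le_mul_of_nonneg_left h6 hγ.le
    have e1 : γ * (2 * ((1 / (2 * γ) - ρ / 2) * ‖z' - z‖ ^ 2)) =
      (1 - γ * ρ) * ‖z' - z‖ ^ 2 := by field_simp
    have e2 : γ * (1 / (2 * γ) * (2 * inner ℝ (y' - y) (z' - z))) =
      inner ℝ (y' - y) (z' - z) := by field_simp
    linarith
  rw [inv_mul_eq_div, le_div_iff₀ hpos]
  rcases (norm_nonneg (z' - z)).eq_or_lt with h0 | h0
  · rw [← h0, zero_mul]; positivity
  · refine le_of_mul_le_mul_right ?_ h0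
    linarith

theorem proxSet_eq_singleton {g : Rn n → EReal} {γ ρ : ℝ} (hg : IsProper g)
    (hw : IsWeaklyConvex ρ g) (hγ : 0 < γ) (hγρ : γ * ρ < 1) {y z : Rn n}
    (hz : z ∈ proxSet g γ y) : proxSet g γ y = {z} := by
  refine Set.eq_singleton_iff_unique_mem.2 ⟨hz, fun u hu => ?_⟩
  have := norm_sub_le_of_mem_proxSet hg hw hγ hγρ hz hu
  rw [sub_self, norm_zero, mul_zero] at this
  exact sub_eq_zero.1 (norm_le_zero_iff.1 this)

theorem prox_mem {g : Rn n → EReal} {γ : ℝ} {y : Rn n} (h : (proxSet g γ y).Nonempty) :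
    prox g γ y ∈ proxSet g γ y := by
  rw [prox, dif_pos h]
  exact h.some_mem

theorem lipschitzWith_prox {g : Rn n → EReal} {γ ρ : ℝ} (hg : IsProper g)
    (hw : IsWeaklyConvex ρ g) (hγ : 0 < γ) (hγρ : γ * ρ < 1)
    (hne : ∀ y, (proxSet g γ y).Nonempty) :
    LipschitzWith (1 - γ * ρ)⁻¹.toNNReal (prox g γ) := by
  refine LipschitzWith.of_dist_le' fun y y' => ?_
  rw [dist_eq_norm, dist_eq_norm]
  exact norm_sub_le_of_mem_proxSet hg hw hγ hγρ (prox_mem (hne _)) (prox_mem (hne _))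

/-! ### Differentiability of the Moreau envelope. -/

/-- The Moreau envelope, evaluated at the proximal point. -/
noncomputable def moreau (g : Rn n → EReal) (γ : ℝ) (y : Rn n) : ℝ :=
  (g (prox g γ y)).toReal + 1 / (2 * γ) * ‖prox g γ y - y‖ ^ 2

theorem moreau_le {g : Rn n → EReal} {γ : ℝ} (hg : IsProper g)
    (hne : ∀ y, (proxSet g γ y).Nonempty) (y : Rn n) {u : Rn n} (hu : g u ≠ ⊤) :
    moreau g γ y ≤ (g u).toReal + 1 / (2 * γ) * ‖u - y‖ ^ 2 :=
  toReal_add_le_of_mem_proxSet hg (prox_mem (hne y)) hu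

/-- Each of the two proximal points is a competitor in the other's minimization, which bounds the
increment from both sides. The bounds differ from the linear term by `O(‖y' - y‖²)` because the prox
is Lipschitz; its differentiability plays no role. -/
theorem hasGradientAt_moreau {g : Rn n → EReal} {γ ρ : ℝ} (hg : IsProper g)
    (hw : IsWeaklyConvex ρ g) (hγ : 0 < γ) (hγρ : γ * ρ < 1)
    (hne : ∀ y, (proxSet g γ y).Nonempty) (y : Rn n) :
    HasGradientAt (moreau g γ) (γ⁻¹ • (y - prox g γ y)) y := by
  rw [hasGradientAt_iff_isLittleO]
  refine Asymptotics.IsBigO.trans_isLittleO ?_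
    (Asymptotics.isLittleO_pow_sub_sub y (m := 2) one_lt_two)
  set K := (1 - γ * ρ)⁻¹ with hK
  have hK0 : 0 < K := inv_pos.2 (by linarith)
  refine Asymptotics.IsBigO.of_bound (1 / (2 * γ) + K / γ) (Eventually.of_forall fun y' => ?_)
  set z := prox g γ y with hz
  set z' := prox g γ y' with hz'
  have hlip : ‖z' - z‖ ≤ K * ‖y' - y‖ :=
    norm_sub_le_of_mem_proxSet hg hw hγ hγρ (prox_mem (hne _)) (prox_mem (hne _))
  have hup := moreau_le hg hne y' (ne_top_of_mem_proxSet hg (prox_mem (hne y)))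
  have hlo := moreau_le hg hne y (ne_top_of_mem_proxSet hg (prox_mem (hne y')))
  have hm : moreau g γ y = (g z).toReal + 1 / (2 * γ) * ‖z - y‖ ^ 2 := rfl
  have hm' : moreau g γ y' = (g z').toReal + 1 / (2 * γ) * ‖z' - y'‖ ^ 2 := rfl
  rw [← hz] at hup
  rw [← hz'] at hlo
  rw [norm_pow, norm_norm, Real.norm_eq_abs, inner_smul_left, conj_trivial]
  set v := y' - y with hv
  have e1 : ‖z - y'‖ ^ 2 = ‖z - y‖ ^ 2 + 2 * inner ℝ (y - z) v + ‖v‖ ^ 2 := by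
    rw [show z - y' = -((y - z) + v) by rw [hv]; abel, norm_neg, norm_add_sq_real,
      norm_sub_rev y z]
  have e2 : ‖z' - y‖ ^ 2 = ‖z' - y'‖ ^ 2 - 2 * inner ℝ (y - z) v - 2 * ‖v‖ ^ 2 +
      2 * inner ℝ (z' - z) v + ‖v‖ ^ 2 := by
    rw [show z' - y = (z' - y') + v by rw [hv]; abel, norm_add_sq_real,
      show z' - y' = (z' - z) - (y - z) - v by rw [hv]; abel]
    rw [inner_sub_left, inner_sub_left, real_inner_self_eq_norm_sq]
    ring
  have e3 := abs_le.1 (abs_real_inner_le_norm (z' - z) v)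
  have e4 : ‖z' - z‖ * ‖v‖ ≤ K * ‖v‖ ^ 2 := by
    rw [pow_two, ← mul_assoc]; gcongr
  rw [e1] at hup
  rw [e2] at hlo
  have e5 : 1 / (2 * γ) * (2 * inner ℝ (y - z) v) = γ⁻¹ * inner ℝ (y - z) v := by field_simp
  have e6 : 1 / (2 * γ) * (2 * inner ℝ (z' - z) v) ≤ K / γ * ‖v‖ ^ 2 := by
    calc _ ≤ 1 / (2 * γ) * (2 * (K * ‖v‖ ^ 2)) := by gcongr; linarith [e3.2]
      _ = _ := by field_simp
  have e7 : 0 ≤ 1 / (2 * γ) * ‖v‖ ^ 2 := by positivity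
  have e8 : 0 ≤ K / γ * ‖v‖ ^ 2 := by positivity
  rw [abs_le]
  constructor <;> nlinarith

/-! ### The forward-backward envelope and its gradient. -/

theorem fbeExt_integrand {f : Rn n → ℝ} {γ : ℝ} (hγ : 0 < γ) (x u : Rn n) :
    f x + inner ℝ (gradient f x) (u - x) + 1 / (2 * γ) * ‖u - x‖ ^ 2 =
      f x - γ / 2 * ‖gradient f x‖ ^ 2 + 1 / (2 * γ) * ‖u - (x - γ • gradient f x)‖ ^ 2 := by
  rw [show u - (x - γ • gradient f x) = (u - x) + γ • gradient f x by abel, norm_add_sq_real,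
    inner_smul_right, norm_smul, Real.norm_of_nonneg hγ.le, real_inner_comm]
  field_simp
  ring

theorem fbeExt_eq {f : Rn n → ℝ} {g : Rn n → EReal} {γ : ℝ} (hg : IsProper g) (hγ : 0 < γ)
    (hne : ∀ y, (proxSet g γ y).Nonempty) (x : Rn n) :
    fbeExt f g γ x = ((f x - γ / 2 * ‖gradient f x‖ ^ 2 +
      moreau g γ (x - γ • gradient f x) : ℝ) : EReal) := by
  refine le_antisymm ?_ ?_
  · refine (iInf_le _ (prox g γ (x - γ • gradient f x))).trans (le_of_eq ?_)
    rw [fbeExt_integrand hγ,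
      ← hg.coe_toReal (ne_top_of_mem_proxSet hg (prox_mem (hne (x - γ • gradient f x)))),
      ← EReal.coe_add, moreau]
    congr 1
    ring
  · refine le_iInf fun u => ?_
    by_cases hu : g u = ⊤
    · rw [hu, EReal.coe_add_top]
      exact le_top
    · rw [fbeExt_integrand hγ, ← hg.coe_toReal hu, ← EReal.coe_add, EReal.coe_le_coe_iff]
      linarith [moreau_le hg hne (x - γ • gradient f x) hu]

theorem fbe_eq {f : Rn n → ℝ} {g : Rn n → EReal} {γ : ℝ} (hg : IsProper g) (hγ : 0 < γ)
    (hne : ∀ y, (proxSet g γ y).Nonempty) (x : Rn n) :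
    fbe f g γ x = f x - γ / 2 * ‖gradient f x‖ ^ 2 + moreau g γ (x - γ • gradient f x) := by
  rw [fbe, fbeExt_eq hg hγ hne, EReal.toReal_coe]

/-- The competitor `u = x` gives this. It makes `φ_γ(x⁰)` a real level to which the boundedness
assumption on `φ` applies, even when `φ(x⁰) = +∞`. -/
theorem fbe_le_objective {f : Rn n → ℝ} {g : Rn n → EReal} {γ : ℝ} (hg : IsProper g) (hγ : 0 < γ)
    (hne : ∀ y, (proxSet g γ y).Nonempty) (x : Rn n) :
    (fbe f g γ x : EReal) ≤ objective f g x := by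
  rw [fbe_eq hg hγ hne, ← fbeExt_eq hg hγ hne]
  refine (iInf_le _ x).trans (le_of_eq ?_)
  simp [objective]

theorem IsC2Plus.hasGradientAt {f : Rn n → ℝ} (hf : IsC2Plus f) (u : Rn n) :
    HasGradientAt f (gradient f u) u :=
  (hf.1.differentiable (by norm_num) u).hasGradientAt

theorem IsC2Plus.hasFDerivAt_gradient {f : Rn n → ℝ} (hf : IsC2Plus f) (u : Rn n) :
    HasFDerivAt (gradient f) (hess f u) u := by
  have h1 : ContDiff ℝ 1 (fderiv ℝ f) := hf.1.fderiv_right (by norm_num)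
  have h2 : Differentiable ℝ (gradient f) :=
    (InnerProductSpace.toDual ℝ (Rn n)).symm.toContinuousLinearEquiv.differentiable.comp
      (h1.differentiable (by norm_num))
  exact (h2 u).hasFDerivAt

/-- The gradient of the forward-backward envelope is `Q(x)` (here its adjoint) times the
residual. -/
theorem hasGradientAt_fbe {f : Rn n → ℝ} {g : Rn n → EReal} {γ ρ : ℝ} (hf : IsC2Plus f)
    (hg : IsProper g) (hw : IsWeaklyConvex ρ g) (hγ : 0 < γ) (hγρ : γ * ρ < 1)
    (hne : ∀ y, (proxSet g γ y).Nonempty) (x : Rn n) :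
    HasGradientAt (fbe f g γ) ((Qop f γ x).adjoint (residual f g γ x)) x := by
  rw [show fbe f g γ = fun x => f x - γ / 2 * ‖gradient f x‖ ^ 2 +
    moreau g γ (x - γ • gradient f x) from funext (fbe_eq hg hγ hne), hasGradientAt_iff_hasFDerivAt]
  have hH := hf.hasFDerivAt_gradient x
  have h1 := (hf.hasGradientAt x).hasFDerivAt
  have h2 := (hH.norm_sq).const_mul (γ / 2)
  have h3 : HasFDerivAt (fun x => x - γ • gradient f x) (Qop f γ x) x :=
    (hasFDerivAt_id x).sub (hH.const_smul γ)
  have h4 := (hasGradientAt_moreau hg hw hγ hγρ hne (x - γ • gradient f x)).hasFDerivAt.comp x h3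
  refine ((h1.sub h2).add h4).congr_fderiv ?_
  ext v
  -- The smooth part contributes `⟨∇f, Q v⟩` and the Moreau part `⟨R - ∇f, Q v⟩`, so `∇f` cancels.
  -- Using the adjoint of `Q` avoids appealing to symmetry of the Hessian.
  have hres : γ⁻¹ • (x - γ • gradient f x - prox g γ (x - γ • gradient f x)) =
      residual f g γ x - gradient f x := by
    rw [residual, sub_right_comm, smul_sub, smul_smul, inv_mul_cancel₀ hγ.ne', one_smul]
  rw [hres]
  simp [ContinuousLinearMap.adjoint_inner_left, Qop]
  ring

theorem continuous_residual {f : Rn n → ℝ} {g : Rn n → EReal} {γ : ℝ}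
    (hf : Continuous (gradient f)) (hp : Continuous (prox g γ)) :
    Continuous (residual f g γ) := by
  unfold residual
  fun_prop

theorem continuous_adjoint_Qop_residual {f : Rn n → ℝ} {g : Rn n → EReal} {γ : ℝ}
    (hf : IsC2Plus f) (hr : Continuous (residual f g γ)) :
    Continuous fun x => (Qop f γ x).adjoint (residual f g γ x) := by
  have hQ : Continuous (Qop f γ) := continuous_const.sub (hf.2.continuous.const_smul γ)
  exact ((ContinuousLinearMap.adjoint.continuous).comp hQ).clm_apply hr

/-! ### Uniform bounds on the model Hessians. -/

/-- Every Jacobian of `F` lies in the ball of radius `K`, which is closed and convex and so absorbs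
limits and convex hulls. -/
theorem norm_le_of_mem_clarkeJacobian {F : Rn n → Rn n} {K : NNReal} (hF : LipschitzWith K F)
    {y : Rn n} {A : Rn n →L[ℝ] Rn n} (hA : A ∈ clarkeJacobian F y) : ‖A‖ ≤ K := by
  have : clarkeJacobian F y ⊆ Metric.closedBall 0 K := by
    refine convexHull_min ?_ (convex_closedBall _ _)
    rintro A ⟨u, -, -, hA⟩
    refine Metric.isClosed_closedBall.mem_of_tendsto hA (Eventually.of_forall fun i => ?_)
    simpa using norm_fderiv_le_of_lipschitz ℝ hF
  simpa using this hA

theorem norm_Qop_le {f : Rn n → ℝ} {L : NNReal} {γ : ℝ} (hL : LipschitzWith L (gradient f))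
    (hγ : 0 < γ) (hγL : γ * (L : ℝ) < 1) (x : Rn n) : ‖Qop f γ x‖ ≤ 2 := by
  have h1 : ‖hess f x‖ ≤ L := norm_fderiv_le_of_lipschitz ℝ hL
  have h2 : ‖γ • hess f x‖ ≤ γ * L := by
    rw [norm_smul, Real.norm_of_nonneg hγ.le]; gcongr
  have h3 := norm_sub_le (ContinuousLinearMap.id ℝ (Rn n)) (γ • hess f x)
  have h4 := ContinuousLinearMap.norm_id_le (𝕜 := ℝ) (E := Rn n)
  rw [Qop]
  linarith

theorem norm_Bop_le {f : Rn n → ℝ} {γ K : ℝ} (hγ : 0 < γ) {x : Rn n} {P : Rn n →L[ℝ] Rn n}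
    (hQ : ‖Qop f γ x‖ ≤ 2) (hP : ‖P‖ ≤ K) : ‖Bop f γ x P‖ ≤ γ⁻¹ * (2 * (1 + K * 2)) := by
  have hK : 0 ≤ K := (norm_nonneg _).trans hP
  rw [Bop, norm_smul, Real.norm_of_nonneg (inv_nonneg.2 hγ.le)]
  have h1 : ‖P.comp (Qop f γ x)‖ ≤ K * 2 :=
    (ContinuousLinearMap.opNorm_comp_le _ _).trans (by gcongr)
  have h2 := norm_sub_le (ContinuousLinearMap.id ℝ (Rn n)) (P.comp (Qop f γ x))
  have h4 := ContinuousLinearMap.norm_id_le (𝕜 := ℝ) (E := Rn n)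
  have h5 := ContinuousLinearMap.opNorm_comp_le (Qop f γ x)
    (ContinuousLinearMap.id ℝ (Rn n) - P.comp (Qop f γ x))
  have h6 : ‖(Qop f γ x).comp (ContinuousLinearMap.id ℝ (Rn n) - P.comp (Qop f γ x))‖ ≤
      2 * (1 + K * 2) := h5.trans (by gcongr; linarith)
  gcongr

/-! ### Sublevel sets, lower bounds and existence of proximal points. -/

/-- The forward-backward step decreases the objective sufficiently below the envelope. -/
theorem objective_prox_add_le_fbe {f : Rn n → ℝ} {g : Rn n → EReal} {L : NNReal} {γ : ℝ}
    (hf : IsC2Plus f) (hL : LipschitzWith L (gradient f)) (hg : IsProper g) (hγ : 0 < γ)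
    (hne : ∀ y, (proxSet g γ y).Nonempty) (x : Rn n) :
    f (prox g γ (x - γ • gradient f x)) + (g (prox g γ (x - γ • gradient f x))).toReal +
      (1 / (2 * γ) - L / 2) * ‖prox g γ (x - γ • gradient f x) - x‖ ^ 2 ≤ fbe f g γ x := by
  set z := prox g γ (x - γ • gradient f x) with hz
  have h1 := (abs_le.1 (abs_sub_sub_inner_le_of_lipschitzWith_gradient hf.hasGradientAt hL
    x (z - x))).2
  rw [add_sub_cancel] at h1
  rw [fbe_eq hg hγ hne, moreau, ← hz]
  have h2 := fbeExt_integrand (f := f) hγ x z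
  linarith

/-- The proximal point `z` of `u` lies in the bounded sublevel set of the objective, and the gap
`s‖z - u‖² ≤ a - m` keeps `u` close to `z`. -/
theorem isBounded_fbe_sublevel {f : Rn n → ℝ} {g : Rn n → EReal} {L : NNReal} {γ m a : ℝ}
    (hf : IsC2Plus f) (hL : LipschitzWith L (gradient f)) (hg : IsProper g) (hγ : 0 < γ)
    (hγL : γ * (L : ℝ) < 1) (hne : ∀ y, (proxSet g γ y).Nonempty)
    (hm : ∀ u, g u ≠ ⊤ → m ≤ f u + (g u).toReal)
    (hlevel : Bornology.IsBounded {u | objective f g u ≤ (a : EReal)}) :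
    Bornology.IsBounded {u | fbe f g γ u ≤ a} := by
  obtain ⟨R, hR⟩ := hlevel.subset_closedBall 0
  set s := 1 / (2 * γ) - L / 2 with hs
  have hs0 : 0 < s := by
    have : s = (1 - γ * L) / (2 * γ) := by rw [hs]; field_simp
    rw [this]
    have : 0 < 1 - γ * (L : ℝ) := by linarith
    positivity
  refine Metric.isBounded_closedBall (x := (0 : Rn n)) (r := R + ((a - m) / s + 1)) |>.subset ?_
  intro u hu
  have h1 := objective_prox_add_le_fbe hf hL hg hγ hne u
  rw [← hs] at h1
  set z := prox g γ (u - γ • gradient f u) with hz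
  have hzt : g z ≠ ⊤ := ne_top_of_mem_proxSet hg (prox_mem (hne _))
  have hu' : fbe f g γ u ≤ a := hu
  have h2 : z ∈ {u | objective f g u ≤ (a : EReal)} := by
    change (f z : EReal) + g z ≤ a
    rw [← hg.coe_toReal hzt]
    norm_cast
    have : 0 ≤ s * ‖z - u‖ ^ 2 := by positivity
    linarith
  have h3 : ‖z‖ ≤ R := by simpa using hR h2
  have h4 : ‖z - u‖ ^ 2 ≤ (a - m) / s := by
    rw [le_div_iff₀ hs0]
    linarith [hm z hzt]
  have h5 : ‖z - u‖ ≤ (a - m) / s + 1 := by nlinarith [sq_nonneg (‖z - u‖ - 1)]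
  have h6 := norm_sub_norm_le u z
  rw [norm_sub_rev] at h6
  rw [mem_closedBall_zero_iff]
  linarith

/-- A minimizer of a proper objective bounds it from below by a real number. -/
theorem exists_lower_bound_objective {f : Rn n → ℝ} {g : Rn n → EReal} (hg : IsProper g)
    (h : ∃ z, ∀ u, objective f g z ≤ objective f g u) :
    ∃ m : ℝ, ∀ u, g u ≠ ⊤ → m ≤ f u + (g u).toReal := by
  obtain ⟨z, hz⟩ := h
  have hzt : g z ≠ ⊤ := by
    intro htop
    obtain ⟨u, hu⟩ := hg.2
    have := hz u
    rw [objective, objective, htop, EReal.coe_add_top, top_le_iff, ← hg.coe_toReal hu] at this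
    exact EReal.coe_ne_top _ (by rwa [← EReal.coe_add] at this)
  refine ⟨f z + (g z).toReal, fun u hu => ?_⟩
  have := hz u
  rw [objective, objective, ← hg.coe_toReal hu, ← hg.coe_toReal hzt] at this
  exact_mod_cast this

/-- The descent lemma bounds `f` above by a quadratic of curvature `L`, so `g ≥ m - f` has a concave
quadratic minorant. Existence thus rests on `γL < 1`, uniqueness on `γρ < 1`. -/
theorem proxSet_nonempty_of_lower_bound {f : Rn n → ℝ} {g : Rn n → EReal} {L : NNReal} {γ m : ℝ}
    (hf : IsC2Plus f) (hL : LipschitzWith L (gradient f)) (hg : IsProper g)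
    (hlsc : LowerSemicontinuous g) (hγ : 0 < γ) (hγL : γ * (L : ℝ) < 1)
    (hm : ∀ u, g u ≠ ⊤ → m ≤ f u + (g u).toReal) (y : Rn n) : (proxSet g γ y).Nonempty := by
  refine proxSet_nonempty (a := m - f 0) (b := ‖gradient f 0‖) hg hlsc hγ hγL (norm_nonneg _)
    (fun u hu => ?_) y
  have h1 := (abs_le.1 (abs_sub_sub_inner_le_of_lipschitzWith_gradient hf.hasGradientAt hL 0 u)).2
  rw [zero_add] at h1
  have h2 := real_inner_le_norm (gradient f 0) u
  linarith [hm u hu]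

/-- The stopping test depends only on `x k` and `P k`, both frozen once it succeeds. -/
theorem IsRun.stops_of_le {f : Rn n → ℝ} {g : Rn n → EReal} {γ μ₁ μ₂ c₁ c₂ c₃ : ℝ}
    {x : ℕ → Rn n} {δ : ℕ → ℝ} {P : ℕ → Rn n →L[ℝ] Rn n} {d : ℕ → Rn n}
    (h : IsRun f g γ μ₁ μ₂ c₁ c₂ c₃ x δ P d) {k j : ℕ}
    (hk : Stops f g γ (x k) (Bop f γ (x k) (P k))) (hkj : k ≤ j) :
    Stops f g γ (x j) (Bop f γ (x j) (P j)) := by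
  induction j, hkj using Nat.le_induction with
  | base => exact hk
  | succ j _ ih =>
    obtain ⟨h1, -, h3⟩ := h.stopped j ih
    rwa [h1, h3]

end NTRA

/-! ### Reduction of the algorithm to the abstract trust-region result. -/

theorem theorem4p5 {n : ℕ} (f : NTRA.Rn n → ℝ) (g : NTRA.Rn n → EReal)
    (L : NNReal) (ρ γ β μ₁ μ₂ c₁ c₂ c₃ : ℝ)
    (x : ℕ → NTRA.Rn n) (δ : ℕ → ℝ) (P : ℕ → NTRA.Rn n →L[ℝ] NTRA.Rn n) (d : ℕ → NTRA.Rn n)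
    -- assumptions on the problem
    (hf : NTRA.IsC2Plus f)
    (hL : LipschitzWith L (gradient f))
    (hg_proper : NTRA.IsProper g)
    (hg_lsc : LowerSemicontinuous g)
    (hρ : 0 ≤ ρ)
    (hg_weak : NTRA.IsWeaklyConvex ρ g)
    (h_argmin : ∃ z, ∀ u, NTRA.objective f g z ≤ NTRA.objective f g u)
    (h_level : ∀ a : ℝ, (a : EReal) ≤ NTRA.objective f g (x 0) →
      Bornology.IsBounded {u | NTRA.objective f g u ≤ (a : EReal)})
    -- parameters: `0 < γ < min {1 / L, 1 / ρ}`, where `1 / 0 = +∞`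
    (hγ : 0 < γ) (hγL : γ * (L : ℝ) < 1) (hγρ : γ * ρ < 1)
    (hμ₁ : 0 < μ₁) (hμ : μ₁ < μ₂) (hμ₂ : μ₂ < 1)
    (hc₁ : 0 < c₁) (hc : c₁ < c₂) (hc₂ : c₂ < 1) (hc₃ : 1 < c₃)
    -- the run of the algorithm and the sufficient model decrease
    (hrun : NTRA.IsRun f g γ μ₁ μ₂ c₁ c₂ c₃ x δ P d)
    (hβ : 0 < β) (hβ₁ : β < 1)
    (h_decrease : ∀ k, ¬ NTRA.Stops f g γ (x k) (NTRA.Bop f γ (x k) (P k)) →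
      NTRA.SufficientDecrease f g γ β (x k) (δ k) (NTRA.Bop f γ (x k) (P k)) (d k)) :
    -- the proximal map and the envelope are well defined, and the gradients tend to zero
    (∀ y, ∃ z, NTRA.proxSet g γ y = {z}) ∧
    (∀ y, NTRA.fbeExt f g γ y ≠ ⊥ ∧ NTRA.fbeExt f g γ y ≠ ⊤) ∧
    Differentiable ℝ (NTRA.fbe f g γ) ∧
    Filter.Tendsto (fun k => ‖gradient (NTRA.fbe f g γ) (x k)‖) Filter.atTop (nhds 0) := by
  obtain ⟨m, hm⟩ := NTRA.exists_lower_bound_objective hg_proper h_argmin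
  have hne := NTRA.proxSet_nonempty_of_lower_bound hf hL hg_proper hg_lsc hγ hγL hm
  have hgrad := NTRA.hasGradientAt_fbe hf hg_proper hg_weak hγ hγρ hne
  have hlip := NTRA.lipschitzWith_prox hg_proper hg_weak hγ hγρ hne
  refine ⟨fun y => ?_, fun y => ?_, fun y => (hgrad y).differentiableAt, ?_⟩
  · obtain ⟨z, hz⟩ := hne y
    exact ⟨z, NTRA.proxSet_eq_singleton hg_proper hg_weak hγ hγρ hz⟩
  · rw [NTRA.fbeExt_eq hg_proper hγ hne]
    exact ⟨EReal.coe_ne_bot _, EReal.coe_ne_top _⟩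
  have hgeq : ∀ u, gradient (NTRA.fbe f g γ) u =
      (NTRA.Qop f γ u).adjoint (NTRA.residual f g γ u) := fun u => (hgrad u).gradient
  by_cases hterm : ∃ k, NTRA.Stops f g γ (x k) (NTRA.Bop f γ (x k) (P k))
  · obtain ⟨k, hk⟩ := hterm
    refine tendsto_const_nhds.congr' ?_
    filter_upwards [Filter.eventually_ge_atTop k] with j hj
    rw [hgeq, norm_eq_zero.1 (hrun.stops_of_le hk hj).1, map_zero, norm_zero]
  push Not at hterm
  set K := (1 - γ * ρ)⁻¹.toNNReal with hK
  set M := γ⁻¹ * (2 * (1 + (K : ℝ) * 2)) with hM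
  have hM0 : 0 < M := by positivity
  have hB : ∀ k, ‖NTRA.Bop f γ (x k) (P k)‖ ≤ M := fun k =>
    NTRA.norm_Bop_le hγ (NTRA.norm_Qop_le hL hγ hγL _)
      (NTRA.norm_le_of_mem_clarkeJacobian hlip (hrun.select k))
  have hδ : ∀ k, 0 < δ k := by
    intro k
    induction k with
    | zero => exact hrun.radius_pos
    | succ k ih =>
      rw [hrun.radius k (hterm k)]
      split_ifs
      · exact mul_pos hc₁ ih
      · exact mul_pos (hc₁.trans hc) ih
      · exact mul_pos (one_pos.trans hc₃) ih
  have hlow : ∀ u, m ≤ NTRA.fbe f g γ u := by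
    intro u
    refine le_trans ?_ (NTRA.objective_prox_add_le_fbe hf hL hg_proper hγ hne u)
    have h1 := hm _ (NTRA.ne_top_of_mem_proxSet hg_proper
      (NTRA.prox_mem (hne (u - γ • gradient f u))))
    have h2 : 0 ≤ 1 / (2 * γ) - (L : ℝ) / 2 := by
      rw [sub_nonneg, le_div_iff₀ (by positivity)]
      linarith
    have h3 := mul_nonneg h2
      (sq_nonneg ‖NTRA.prox g γ (u - γ • gradient f u) - u‖)
    linarith
  simp only [hgeq]
  refine NTRA.tendsto_norm_gradient_of_trustRegion (φ := NTRA.fbe f g γ)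
    (G := fun u => (NTRA.Qop f γ u).adjoint (NTRA.residual f g γ u))
    (NTRA.continuous_adjoint_Qop_residual hf
      (NTRA.continuous_residual hL.continuous hlip.continuous)) hgrad
    hlow (NTRA.isBounded_fbe_sublevel hf hL hg_proper hγ hγL hne hm
      (h_level _ (NTRA.fbe_le_objective hg_proper hγ hne (x 0))))
    hM0 hB hβ hμ₁ hμ hμ₂ hc₁ hc hc₂ hc₃ (fun k => ?_) (fun k => rfl) hrun.radius_pos
    (fun k => hrun.feasible k (hterm k)) (fun k => hrun.iterate k (hterm k))
    (fun k => hrun.radius k (hterm k)) (fun k => ?_)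
  · simp only [NTRA.model, hgeq, map_zero, inner_zero_right]
    ring
  · refine le_trans ?_ (h_decrease k (hterm k))
    rw [hgeq]
    refine mul_le_mul_of_nonneg_left ?_ (by positivity)
    -- Replacing `‖B k‖` by the uniform bound `M` only shrinks the minimum, and it also covers the
    -- convention for `B k = 0`.
    split_ifs with h0
    · exact min_le_left _ _
    · have : 0 < ‖NTRA.Bop f γ (x k) (P k)‖ := lt_of_le_of_ne (norm_nonneg _) (Ne.symm h0)
      gcongr
      exact hB k
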